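/- Let $B(D)$ denote the space of bounded complex-valued functions on a set $D$ with the sup-norm $\|f\|_\infty=\sup_{x\in D}|f(x)|$ and, for a probability space $(D,\mu)$, let $B_\mu(D)\subset B(D)$ be the subspace of bounded $\mu$-measurable functions, also with the sup-norm. For $n\in\mathbb N=\{1,2,\dots\}$, a class $F$ of complex-valued functions on $D$ and a (semi-)normed space $G$ of functions on $D$, define the linear sampling numbers $$g_n^{\mathrm{lin}}(F,G)=\inf_{\substack{x_1,\dots,x_n\in D\\ \varphi_1,\dots,\varphi_n\in G}}\ \sup_{f\in F}\Big\|f-\sum_{i=1}^n f(x_i)\,\varphi_i\Big\|_G$$ and, for $F\subset G$, the Kolmogorov numbers $$d_n(F,G)=\inf_{\substack{V_n\subset G \text{ linear subspace}\\ \dim V_n=n}}\ \sup_{f\in F}\ \inf_{g\in V_n}\|f-g\|_G,$$ both with values in $[0,\infty]$, where an infimum over the empty set is $\infty$. Write $a_+=\max\{a,0\}$ and $1/\infty=0$. **Theorem.** There is an absolute constant $C>0$ such that the following holds. (1) For any set $D$, any $F\subset B(D)$, and all $n\in\mathbb N$, $$g_{2n}^{\mathrm{lin}}(F,B(D))\le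 C\,\sqrt n\; d_n(F,B(D)).$$ (2) For any probability space $(D,\mu)$, any $F\subset B_\mu(D)$, all $n\in\mathbb N$, and all $1\le p\le\infty$, $$g_{4n}^{\mathrm{lin}}(F,L_p(\mu))\le C\,n^{(1/2-1/p)_+}\; d_n(F,B_\mu(D)).$$ -/

import Mathlib

open scoped ENNReal

noncomputable section

/-- The sup-norm `sup_{x ∈ D} |f x|` of a complex-valued function, as a value in `[0, ∞]`
(the supremum is over all points, not up to null sets). -/
def supNorm {D : Type*} (f : D → ℂ) : ℝ≥0∞ := ⨆ x : D, ‖f x‖ₑ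

/-- The space `B(D)` of bounded complex-valued functions on `D`. -/
def boundedFunctions (D : Type*) : Submodule ℂ (D → ℂ) where
  carrier := {f | ∃ M : ℝ, ∀ x, ‖f x‖ ≤ M}
  add_mem' := by
    rintro f g ⟨M, hM⟩ ⟨M', hM'⟩
    exact ⟨M + M', fun x => (norm_add_le _ _).trans (add_le_add (hM x) (hM' x))⟩
  zero_mem' := ⟨0, fun x => by simp⟩
  smul_mem' := by
    rintro c f ⟨M, hM⟩
    refine ⟨‖c‖ * M, fun x => ?_⟩
    rw [Pi.smul_apply, norm_smul]
    exact mul_le_mul_of_nonneg_left (hM x) (norm_nonneg c)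

/-- The space `B_μ(D)` of bounded `μ`-measurable complex-valued functions on `D`, where
`μ`-measurable means measurable with respect to the completion of the σ-algebra under `μ`
(for complex-valued functions this is `AEMeasurable`). -/
def boundedMeasurableFunctions {D : Type*} [MeasurableSpace D]
    (μ : MeasureTheory.Measure D) : Submodule ℂ (D → ℂ) where
  carrier := {f | f ∈ boundedFunctions D ∧ AEMeasurable f μ}
  add_mem' := fun hf hg => ⟨add_mem hf.1 hg.1, hf.2.add hg.2⟩
  zero_mem' := ⟨zero_mem _, aemeasurable_const⟩
  smul_mem' := fun c _ hf => ⟨Submodule.smul_mem _ c hf.1, hf.2.const_smul c⟩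

/-- The seminormed space `L_p(μ)` of `p`-integrable complex-valued functions on `D`
(functions, not classes of functions; the seminorm is `MeasureTheory.eLpNorm · p μ`). -/
def lpFunctions {D : Type*} [MeasurableSpace D] (p : ℝ≥0∞)
    (μ : MeasureTheory.Measure D) : Submodule ℂ (D → ℂ) where
  carrier := {f | MeasureTheory.MemLp f p μ}
  add_mem' := fun hf hg => hf.add hg
  zero_mem' := MeasureTheory.MemLp.zero
  smul_mem' := fun c _ hf => hf.const_smul c

/-- The `n`-th linear sampling number of a class `F` of complex-valued functions on `D` in a space
`G` of functions on `D` with (semi-)norm `N`: the infimum over all points `x₁, …, xₙ ∈ D` and all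
`φ₁, …, φₙ ∈ G` of the worst case error `sup_{f ∈ F} N (f - ∑ i, f (x i) φ i)`. Values are in
`[0, ∞]`, and an infimum over the empty set is `∞`. -/
def linSamplingNumber {D : Type*} (n : ℕ) (F : Set (D → ℂ))
    (G : Submodule ℂ (D → ℂ)) (N : (D → ℂ) → ℝ≥0∞) : ℝ≥0∞ :=
  ⨅ (x : Fin n → D) (φ : Fin n → D → ℂ) (_ : ∀ i, φ i ∈ G),
    ⨆ f ∈ F, N (f - ∑ i, f (x i) • φ i)

/-- The `n`-th Kolmogorov number of a subset `F` of a space `G` of complex-valued functions on `D`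
with (semi-)norm `N`: the infimum over all `n`-dimensional linear subspaces `V` of `G` of
`sup_{f ∈ F} inf_{g ∈ V} N (f - g)`. Values are in `[0, ∞]`, and an infimum over the empty set
is `∞`. -/
def kolmogorovNumber {D : Type*} (n : ℕ) (F : Set (D → ℂ))
    (G : Submodule ℂ (D → ℂ)) (N : (D → ℂ) → ℝ≥0∞) : ℝ≥0∞ :=
  ⨅ (V : Submodule ℂ (D → ℂ)) (_ : V ≤ G) (_ : FiniteDimensional ℂ V)
    (_ : Module.finrank ℂ V = n), ⨆ f ∈ F, ⨅ g ∈ V, N (f - g)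

end

open scoped ENNReal ComplexOrder
open Matrix MeasureTheory

/-! Let V be an n-dimensional space of bounded functions. If A uses finitely many samples, has
values in V and is the identity on V, then f - A f = (f - g) - A (f - g) for every g in V. So it
suffices to bound A e for e = f - g in terms of s, the sup-norm of e. For A take discrete least
squares, which does not increase the Euclidean norm of the data (`exists_leastSquares`); on 2n
points the data of e have squared norm at most 2n s². What remains is to find 2n points whose values
control the norms of every g in V.

For the sup-norm, take 2n points whose frame matrix has nearly maximal determinant. No exchange of a
point gains much, and averaging over all exchanges gives |g(y)|² ≤ 2 ∑ |g(xᵢ)|²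
(`exists_norm_dotProduct_sq_le`). Hence A e is at most 2√n s.

For L_p, the integral of |g|² must also be at most (const / n) ∑ |g(xᵢ)|². Mix μ in equal parts with
the uniform distribution on the points just found, and apply a lower barrier argument in the style
of Batson, Spielman and Srivastava to the second moment matrix of the mixture
(`AttainsTrace.exists_le_sum`). The 2n points it selects control both halves of the mixture: the
first gives the L₂ bound, the second returns the sup bound. Interpolation covers the other p
(`eLpNorm_le_of_sq_le_of_integral_sq_le`). -/

/-! ### Lower barrier selection of vectors -/

/-- Every Hermitian quadratic form attains, at some vector of the family `v`, at least its trace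
against `M`. This holds if `M` is the second moment matrix of a random member of the family. -/
def AttainsTrace {D : Type*} {n : ℕ} (v : D → Fin n → ℂ) (M : Matrix (Fin n) (Fin n) ℂ) : Prop :=
  ∀ P : Matrix (Fin n) (Fin n) ℂ, P.IsHermitian →
    ∃ x, (M * P).trace.re ≤ (star (v x) ⬝ᵥ P *ᵥ v x).re

/-- Trace of the Sherman–Morrison formula. -/
lemma trace_inv_add_smul_vecMulVec {n : ℕ} {K : Matrix (Fin n) (Fin n) ℂ} (hK : IsUnit K)
    (t : ℂ) (w : Fin n → ℂ) (h : 1 + t * (star w ⬝ᵥ K⁻¹ *ᵥ w) ≠ 0) :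
    (K + t • vecMulVec w (star w))⁻¹.trace =
      K⁻¹.trace - t * (star w ⬝ᵥ (K⁻¹ * K⁻¹) *ᵥ w) / (1 + t * (star w ⬝ᵥ K⁻¹ *ᵥ w)) := by
  have hdet : IsUnit K.det := (Matrix.isUnit_iff_isUnit_det K).1 hK
  set s := star w ⬝ᵥ K⁻¹ *ᵥ w with hs
  have hinv : (K + t • vecMulVec w (star w))⁻¹ =
      K⁻¹ - (t / (1 + t * s)) • vecMulVec (K⁻¹ *ᵥ w) (star w ᵥ* K⁻¹) := by
    apply Matrix.inv_eq_right_inv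
    have e1 : K * vecMulVec (K⁻¹ *ᵥ w) (star w ᵥ* K⁻¹) = vecMulVec w (star w ᵥ* K⁻¹) := by
      rw [mul_vecMulVec, mulVec_mulVec, Matrix.mul_nonsing_inv _ hdet, one_mulVec]
    have e2 : vecMulVec w (star w) * K⁻¹ = vecMulVec w (star w ᵥ* K⁻¹) := by
      rw [vecMulVec_mul]
    have e3 : vecMulVec w (star w) * vecMulVec (K⁻¹ *ᵥ w) (star w ᵥ* K⁻¹) =
        s • vecMulVec w (star w ᵥ* K⁻¹) := by
      rw [vecMulVec_mul_vecMulVec, vecMulVec_smul, hs]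
    rw [add_mul, mul_sub, mul_sub, Matrix.mul_nonsing_inv _ hdet, Matrix.mul_smul, e1,
      Matrix.smul_mul, e2, Matrix.smul_mul, Matrix.mul_smul, e3]
    have : (t : ℂ) - t / (1 + t * s) - t * (t / (1 + t * s)) * s = 0 := by
      field_simp; ring
    have h0 := congrArg (fun c : ℂ => c • vecMulVec w (star w ᵥ* K⁻¹)) this
    simp only [sub_smul, mul_smul, zero_smul] at h0
    rw [smul_smul (t / (1 + t * s)) s]
    simp only [smul_smul] at h0 ⊢
    rw [← sub_eq_zero, ← h0]
    abel
  rw [hinv, trace_sub, trace_smul, trace_vecMulVec, smul_eq_mul, ← mulVec_mulVec,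
    dotProduct_comm (K⁻¹ *ᵥ w), ← dotProduct_mulVec]
  ring

/-- One barrier step. The shift by 3/4 raises the trace of the inverse by Δ; a rank-one update along
a suitable `v x` lowers it by 3a / (1 + 3b), which is at least Δ. -/
lemma exists_posDef_diagonal_add_vecMulVec {D : Type*} {n : ℕ} {v : D → Fin n → ℂ} (hv : AttainsTrace v 1)
    {l : Fin n → ℝ} (hl : ∀ i, 0 < l i) (hsum : ∑ i, (l i)⁻¹ ≤ 1) :
    ∃ x, ((diagonal fun i => ((l i - 3 / 4 : ℝ) : ℂ)) +
        (3 : ℂ) • vecMulVec (v x) (star (v x))).PosDef ∧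
      ((diagonal fun i => ((l i - 3 / 4 : ℝ) : ℂ)) +
        (3 : ℂ) • vecMulVec (v x) (star (v x)))⁻¹.trace.re ≤ 1 := by
  -- Every eigenvalue is at least 1, so the shift by 3/4 keeps them positive.
  have hl1 : ∀ i, 1 ≤ l i := fun i => by
    have h1 : (l i)⁻¹ ≤ 1 :=
      (Finset.single_le_sum (f := fun i => (l i)⁻¹)
        (fun j _ => (inv_pos.2 (hl j)).le) (Finset.mem_univ i)).trans hsum
    exact (inv_le_one₀ (hl i)).1 h1
  set k : Fin n → ℝ := fun i => l i - 3 / 4 with hk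
  have hk0 : ∀ i, 0 < k i := fun i => by have := hl1 i; simp only [hk]; linarith
  set Δ := ∑ i, (k i)⁻¹ - ∑ i, (l i)⁻¹ with hΔ
  have hterm : ∀ i, (k i)⁻¹ - (l i)⁻¹ = 3 / 4 * ((k i)⁻¹ * (l i)⁻¹) := fun i => by
    have h1 := (hk0 i).ne'
    have h2 := (hl i).ne'
    field_simp
    simp only [hk]; ring
  have hΔ1 : Δ = 3 / 4 * ∑ i, (k i)⁻¹ * (l i)⁻¹ := by
    rw [hΔ, ← Finset.sum_sub_distrib, Finset.mul_sum]
    exact Finset.sum_congr rfl fun i _ => hterm i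
  have hΔ0 : 0 ≤ Δ := by
    rw [hΔ1]
    exact mul_nonneg (by norm_num) (Finset.sum_nonneg fun i _ =>
      mul_nonneg (inv_pos.2 (hk0 i)).le (inv_pos.2 (hl i)).le)
  -- Cauchy–Schwarz with weights `(l i)⁻¹`, whose total is at most 1.
  have hcs : (∑ i, (k i)⁻¹ * (l i)⁻¹) ^ 2 ≤ ∑ i, (k i)⁻¹ ^ 2 * (l i)⁻¹ := by
    have h1 : (∑ i, (k i)⁻¹ * (l i)⁻¹) ^ 2 ≤
        (∑ i, (k i)⁻¹ ^ 2 * (l i)⁻¹) * ∑ i, (l i)⁻¹ := by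
      apply Finset.sum_sq_le_sum_mul_sum_of_sq_le_mul
      · exact fun i _ => mul_nonneg (sq_nonneg _) (inv_pos.2 (hl i)).le
      · exact fun i _ => (inv_pos.2 (hl i)).le
      · intro i _; exact le_of_eq (by ring)
    refine h1.trans (mul_le_of_le_one_right (Finset.sum_nonneg fun i _ => ?_) hsum)
    exact mul_nonneg (sq_nonneg _) (inv_pos.2 (hl i)).le
  have hkey : Δ * (4 / 3 + Δ) ≤ ∑ i, (k i)⁻¹ ^ 2 := by
    have h2 : ∑ i, (k i)⁻¹ ^ 2 =
        ∑ i, (k i)⁻¹ * (l i)⁻¹ + 3 / 4 * ∑ i, (k i)⁻¹ ^ 2 * (l i)⁻¹ := by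
      rw [Finset.mul_sum, ← Finset.sum_add_distrib]
      refine Finset.sum_congr rfl fun i _ => ?_
      have := hterm i
      linear_combination (k i)⁻¹ * this
    rw [h2, hΔ1]
    nlinarith [hcs]
  -- The test form K⁻² - Δ K⁻¹ for K = diag(k): its value at `v x` is a - Δ b, and by `hkey` its
  -- trace is at least Δ(4/3 + Δ) - Δ(Δ + 1) = Δ/3.
  obtain ⟨x, hx⟩ := hv (diagonal fun i => (((k i)⁻¹ ^ 2 - Δ * (k i)⁻¹ : ℝ) : ℂ)) (by
    apply isHermitian_diagonal_of_self_adjoint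
    funext i
    exact Complex.conj_ofReal _)
  have hquad : ∀ d : Fin n → ℝ, star (v x) ⬝ᵥ (diagonal fun i => (d i : ℂ)) *ᵥ v x =
      ((∑ i, d i * ‖v x i‖ ^ 2 : ℝ) : ℂ) := fun d => by
    rw [dotProduct, Complex.ofReal_sum]
    refine Finset.sum_congr rfl fun i _ => ?_
    rw [mulVec_diagonal, Pi.star_apply, Complex.ofReal_mul, Complex.ofReal_pow,
      ← Complex.conj_mul']
    simp only [RCLike.star_def]
    ring
  rw [one_mul, hquad, Complex.ofReal_re, trace_diagonal, ← Complex.ofReal_sum,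
    Complex.ofReal_re] at hx
  set a := ∑ i, (k i)⁻¹ ^ 2 * ‖v x i‖ ^ 2 with ha
  set b := ∑ i, (k i)⁻¹ * ‖v x i‖ ^ 2 with hb
  have hx' : ∑ i, (k i)⁻¹ ^ 2 - Δ * ∑ i, (k i)⁻¹ ≤ a - Δ * b := by
    rw [ha, hb, Finset.mul_sum, Finset.mul_sum, ← Finset.sum_sub_distrib,
      ← Finset.sum_sub_distrib]
    refine hx.trans_eq (Finset.sum_congr rfl fun i _ => by ring)
  have hab : Δ * (1 / 3 + b) ≤ a := by
    have h3 : ∑ i, (k i)⁻¹ ≤ Δ + 1 := by rw [hΔ]; linarith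
    nlinarith [mul_le_mul_of_nonneg_left h3 hΔ0]
  have hb0 : 0 ≤ b := Finset.sum_nonneg fun i _ =>
    mul_nonneg (inv_pos.2 (hk0 i)).le (sq_nonneg _)
  have hKpos : (diagonal fun i => ((k i : ℝ) : ℂ)).PosDef :=
    Matrix.PosDef.diagonal fun i => by simpa using hk0 i
  have hKinv : (diagonal fun i => ((k i : ℝ) : ℂ))⁻¹ = diagonal fun i => (((k i)⁻¹ : ℝ) : ℂ) := by
    apply Matrix.inv_eq_right_inv
    rw [diagonal_mul_diagonal, ← diagonal_one]
    congr 1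
    funext i
    rw [← Complex.ofReal_mul, mul_inv_cancel₀ (hk0 i).ne', Complex.ofReal_one]
  refine ⟨x, ?_, ?_⟩
  · refine hKpos.add_posSemidef ?_
    exact (posSemidef_vecMulVec_self_star _).smul (by norm_num)
  · have hs : star (v x) ⬝ᵥ (diagonal fun i => ((k i : ℝ) : ℂ))⁻¹ *ᵥ v x = ((b : ℝ) : ℂ) := by
      rw [hKinv, hquad]
    have hs2 : star (v x) ⬝ᵥ ((diagonal fun i => ((k i : ℝ) : ℂ))⁻¹ *
        (diagonal fun i => ((k i : ℝ) : ℂ))⁻¹) *ᵥ v x = ((a : ℝ) : ℂ) := by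
      rw [hKinv, diagonal_mul_diagonal, ha]
      simp only [← Complex.ofReal_mul]
      rw [hquad]
      simp only [pow_two]
    have hne : (1 : ℂ) + 3 * ((b : ℝ) : ℂ) ≠ 0 := by
      have : (1 : ℝ) + 3 * b ≠ 0 := by positivity
      exact_mod_cast this
    rw [trace_inv_add_smul_vecMulVec hKpos.isUnit 3 _ (by rw [hs]; exact hne), hs, hs2, hKinv,
      trace_diagonal]
    have hcast : (∑ i, (((k i)⁻¹ : ℝ) : ℂ)) - 3 * (a : ℂ) / (1 + 3 * (b : ℂ)) =
        ((∑ i, (k i)⁻¹ - 3 * a / (1 + 3 * b) : ℝ) : ℂ) := by push_cast; rfl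
    rw [hcast, Complex.ofReal_re]
    have h4 : Δ ≤ 3 * a / (1 + 3 * b) := by
      rw [le_div_iff₀ (by positivity)]
      nlinarith
    rw [hΔ] at h4
    linarith

lemma Matrix.PosDef.exists_unitary_diagonal {n : ℕ} {B : Matrix (Fin n) (Fin n) ℂ}
    (hB : B.PosDef) : ∃ (U : Matrix (Fin n) (Fin n) ℂ) (l : Fin n → ℝ), Uᴴ * U = 1 ∧ U * Uᴴ = 1 ∧
      (∀ i, 0 < l i) ∧ B = U * (diagonal fun i => (l i : ℂ)) * Uᴴ := by
  refine ⟨hB.isHermitian.eigenvectorUnitary, hB.isHermitian.eigenvalues, ?_, ?_,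
    hB.eigenvalues_pos, ?_⟩
  · exact Unitary.coe_star_mul_self _
  · exact Unitary.coe_mul_star_self _
  · have := hB.isHermitian.spectral_theorem
    rwa [Unitary.conjStarAlgAut_apply] at this

lemma AttainsTrace.comp_mulVec {D : Type*} {n : ℕ} {v : D → Fin n → ℂ}
    {M : Matrix (Fin n) (Fin n) ℂ} (hv : AttainsTrace v M) (T : Matrix (Fin n) (Fin n) ℂ) :
    AttainsTrace (fun x => T *ᵥ v x) (T * M * Tᴴ) := by
  intro P hP
  obtain ⟨x, hx⟩ := hv (Tᴴ * P * T) (isHermitian_conjTranspose_mul_mul T hP)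
  refine ⟨x, ?_⟩
  have h1 : (T * M * Tᴴ * P).trace = (M * (Tᴴ * P * T)).trace := by
    rw [Matrix.mul_assoc, Matrix.mul_assoc, trace_mul_comm]
    simp only [Matrix.mul_assoc]
  have h2 : star (T *ᵥ v x) ⬝ᵥ P *ᵥ T *ᵥ v x = star (v x) ⬝ᵥ (Tᴴ * P * T) *ᵥ v x := by
    rw [star_mulVec, ← dotProduct_mulVec, mulVec_mulVec, mulVec_mulVec, Matrix.mul_assoc]
  rw [h1, h2]
  exact hx

/-- Unitary conjugation preserves the hypotheses and the trace of the inverse, which reduces the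
barrier step to a diagonal matrix. -/
lemma exists_posDef_add_vecMulVec {D : Type*} {n : ℕ} {v : D → Fin n → ℂ}
    (hv : AttainsTrace v 1) {B : Matrix (Fin n) (Fin n) ℂ} (hB : B.PosDef)
    (htr : B⁻¹.trace.re ≤ 1) :
    ∃ x, (B - (3 / 4 : ℂ) • 1 + (3 : ℂ) • vecMulVec (v x) (star (v x))).PosDef ∧
      (B - (3 / 4 : ℂ) • 1 + (3 : ℂ) • vecMulVec (v x) (star (v x)))⁻¹.trace.re ≤ 1 := by
  obtain ⟨U, l, hU, hU', hl, hBU⟩ := hB.exists_unitary_diagonal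
  have hinv : ∀ X : Matrix (Fin n) (Fin n) ℂ, (U * X * Uᴴ)⁻¹.trace = X⁻¹.trace := by
    intro X
    rw [Matrix.mul_inv_rev, Matrix.mul_inv_rev, Matrix.inv_eq_right_inv hU,
      Matrix.inv_eq_right_inv hU', trace_mul_comm, Matrix.mul_assoc, hU, Matrix.mul_one]
  have hdinv : (diagonal fun i => ((l i : ℝ) : ℂ))⁻¹ = diagonal fun i => (((l i)⁻¹ : ℝ) : ℂ) := by
    apply Matrix.inv_eq_right_inv
    rw [diagonal_mul_diagonal, ← diagonal_one]
    congr 1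
    funext i
    rw [← Complex.ofReal_mul, mul_inv_cancel₀ (hl i).ne', Complex.ofReal_one]
  have hsum : ∑ i, (l i)⁻¹ ≤ 1 := by
    rw [hBU, hinv, hdinv, trace_diagonal, ← Complex.ofReal_sum, Complex.ofReal_re] at htr
    exact htr
  have hv' : AttainsTrace (fun x => Uᴴ *ᵥ v x) 1 := by
    have := hv.comp_mulVec Uᴴ
    rwa [Matrix.mul_one, conjTranspose_conjTranspose, hU] at this
  obtain ⟨x, hx, hx'⟩ := exists_posDef_diagonal_add_vecMulVec hv' hl hsum
  have hconj : B - (3 / 4 : ℂ) • 1 + (3 : ℂ) • vecMulVec (v x) (star (v x)) =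
      U * ((diagonal fun i => ((l i - 3 / 4 : ℝ) : ℂ)) +
        (3 : ℂ) • vecMulVec (Uᴴ *ᵥ v x) (star (Uᴴ *ᵥ v x))) * Uᴴ := by
    have e1 : (diagonal fun i => ((l i - 3 / 4 : ℝ) : ℂ)) =
        (diagonal fun i => (l i : ℂ)) - (3 / 4 : ℂ) • 1 := by
      rw [smul_one_eq_diagonal, diagonal_sub]
      congr 1
      funext i
      push_cast
      rfl
    have e2 : U * vecMulVec (Uᴴ *ᵥ v x) (star (Uᴴ *ᵥ v x)) * Uᴴ =
        vecMulVec (v x) (star (v x)) := by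
      rw [mul_vecMulVec, vecMulVec_mul, mulVec_mulVec, hU', one_mulVec, star_mulVec,
        conjTranspose_conjTranspose, vecMul_vecMul, hU', vecMul_one]
    rw [Matrix.mul_add, Matrix.add_mul, Matrix.mul_smul, Matrix.smul_mul, e2, e1, Matrix.mul_sub,
      Matrix.sub_mul, ← hBU, Matrix.mul_smul, Matrix.smul_mul, Matrix.mul_one, hU']
  refine ⟨x, ?_, ?_⟩
  · rw [hconj]
    exact hx.mul_mul_conjTranspose_same
      (Matrix.vecMul_injective_of_isUnit (.of_mul_eq_one _ hU'))
  · rw [hconj, hinv]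
    exact hx'

/-- Iterates the barrier step from n · 1, the multiple of the identity whose inverse has trace
exactly 1. -/
lemma exists_posDef_add_sum_vecMulVec {D : Type*} {n : ℕ} (hn : n ≠ 0) {v : D → Fin n → ℂ}
    (hv : AttainsTrace v 1) (m : ℕ) :
    ∃ x : Fin m → D, ((n - 3 / 4 * m : ℂ) • (1 : Matrix (Fin n) (Fin n) ℂ) +
        (3 : ℂ) • ∑ i, vecMulVec (v (x i)) (star (v (x i)))).PosDef ∧
      ((n - 3 / 4 * m : ℂ) • (1 : Matrix (Fin n) (Fin n) ℂ) +
        (3 : ℂ) • ∑ i, vecMulVec (v (x i)) (star (v (x i))))⁻¹.trace.re ≤ 1 := by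
  induction m with
  | zero =>
    have hn' : (n : ℂ) ≠ 0 := by exact_mod_cast hn
    refine ⟨Fin.elim0, ?_, ?_⟩
    · simp only [Nat.cast_zero, mul_zero, sub_zero, Finset.univ_eq_empty, Finset.sum_empty,
        smul_zero, add_zero]
      exact PosDef.one.smul (by exact_mod_cast Nat.pos_of_ne_zero hn)
    · simp only [Nat.cast_zero, mul_zero, sub_zero, Finset.univ_eq_empty, Finset.sum_empty,
        smul_zero, add_zero]
      have : ((n : ℂ) • (1 : Matrix (Fin n) (Fin n) ℂ))⁻¹ = (n : ℂ)⁻¹ • 1 := by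
        apply Matrix.inv_eq_right_inv
        rw [Matrix.smul_mul, Matrix.mul_smul, smul_smul, mul_inv_cancel₀ hn', Matrix.one_mul,
          one_smul]
      rw [this, trace_smul, trace_one, Fintype.card_fin, smul_eq_mul, inv_mul_cancel₀ hn']
      simp
  | succ m ih =>
    obtain ⟨x, hx, hx'⟩ := ih
    obtain ⟨y, hy⟩ := exists_posDef_add_vecMulVec hv hx hx'
    refine ⟨Fin.cons y x, ?_⟩
    have hstep : (n - 3 / 4 * ((m + 1 : ℕ) : ℂ) : ℂ) • (1 : Matrix (Fin n) (Fin n) ℂ) +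
        (3 : ℂ) • ∑ i, vecMulVec (v (Fin.cons (α := fun _ => D) y x i))
          (star (v (Fin.cons (α := fun _ => D) y x i))) =
        (n - 3 / 4 * m : ℂ) • (1 : Matrix (Fin n) (Fin n) ℂ) +
          (3 : ℂ) • ∑ i, vecMulVec (v (x i)) (star (v (x i))) - (3 / 4 : ℂ) • 1 +
          (3 : ℂ) • vecMulVec (v y) (star (v y)) := by
      rw [Fin.sum_univ_succ, show (n - 3 / 4 * ((m + 1 : ℕ) : ℂ) : ℂ) =
        (n - 3 / 4 * m : ℂ) - 3 / 4 by push_cast; ring, sub_smul]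
      simp only [Fin.cons_zero, Fin.cons_succ, smul_add]
      abel
    rw [hstep]
    exact hy

lemma AttainsTrace.exists_le_sum {D : Type*} {n : ℕ} (hn : n ≠ 0) {v : D → Fin n → ℂ}
    {M : Matrix (Fin n) (Fin n) ℂ} (hM : M.PosDef) (hv : AttainsTrace v M) :
    ∃ x : Fin (2 * n) → D, ∀ w : Fin n → ℂ,
      (star w ⬝ᵥ M *ᵥ w).re ≤ 6 / n * ∑ i, ‖star w ⬝ᵥ v (x i)‖ ^ 2 := by
  have hn' : (0 : ℝ) < n := by exact_mod_cast Nat.pos_of_ne_zero hn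
  obtain ⟨U, l, hU, hU', hl, hMU⟩ := hM.exists_unitary_diagonal
  set S : Matrix (Fin n) (Fin n) ℂ := diagonal fun i => ((√(l i) : ℝ) : ℂ) with hS
  set R : Matrix (Fin n) (Fin n) ℂ := diagonal fun i => (((√(l i))⁻¹ : ℝ) : ℂ) with hR
  have hSS : S * S = diagonal fun i => (l i : ℂ) := by
    rw [hS, diagonal_mul_diagonal]
    congr 1
    funext i
    rw [← Complex.ofReal_mul, Real.mul_self_sqrt (hl i).le]
  have hRS : R * S = 1 := by
    rw [hS, hR, diagonal_mul_diagonal, ← diagonal_one]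
    congr 1
    funext i
    rw [← Complex.ofReal_mul, inv_mul_cancel₀ (Real.sqrt_pos.2 (hl i)).ne', Complex.ofReal_one]
  have hSR : S * R = 1 := mul_eq_one_comm.1 hRS
  have hSH : Sᴴ = S := by
    rw [hS, diagonal_conjTranspose]
    congr 1
    funext i
    exact Complex.conj_ofReal _
  have hML : M = (U * S) * (U * S)ᴴ := by
    rw [conjTranspose_mul, hSH, hMU, ← hSS]
    simp only [Matrix.mul_assoc]
  have hLT : (U * S) * (R * Uᴴ) = 1 := by
    rw [Matrix.mul_assoc, ← Matrix.mul_assoc S, hSR, Matrix.one_mul, hU']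
  have hTL : (R * Uᴴ) * (U * S) = 1 := mul_eq_one_comm.1 hLT
  -- M = L Lᴴ and T = L⁻¹, so passing from `v` to T v turns the trace condition for M into that for
  -- 1.
  set L := U * S
  set T := R * Uᴴ
  have hv' : AttainsTrace (fun x => T *ᵥ v x) 1 := by
    have := hv.comp_mulVec T
    rwa [hML, ← Matrix.mul_assoc, hTL, Matrix.one_mul, ← conjTranspose_mul, hTL,
      conjTranspose_one] at this
  obtain ⟨x, hx, -⟩ := exists_posDef_add_sum_vecMulVec hn hv' (2 * n)
  refine ⟨x, fun w => ?_⟩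
  have h := (hx.posSemidef.re_dotProduct_nonneg (Lᴴ *ᵥ w))
  have h1 : star w ⬝ᵥ M *ᵥ w = star (Lᴴ *ᵥ w) ⬝ᵥ (Lᴴ *ᵥ w) := by
    rw [star_mulVec, conjTranspose_conjTranspose, ← dotProduct_mulVec, mulVec_mulVec, hML]
  have h2 : ∀ i, star (Lᴴ *ᵥ w) ⬝ᵥ vecMulVec (T *ᵥ v (x i)) (star (T *ᵥ v (x i))) *ᵥ (Lᴴ *ᵥ w) =
      ((‖star w ⬝ᵥ v (x i)‖ ^ 2 : ℝ) : ℂ) := by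
    intro i
    have e : star (Lᴴ *ᵥ w) ⬝ᵥ T *ᵥ v (x i) = star w ⬝ᵥ v (x i) := by
      rw [star_mulVec, conjTranspose_conjTranspose, ← dotProduct_mulVec, mulVec_mulVec, hLT,
        one_mulVec]
    have e' : star (T *ᵥ v (x i)) ⬝ᵥ (Lᴴ *ᵥ w) = star (star w ⬝ᵥ v (x i)) := by
      rw [← e, star_dotProduct]
    rw [vecMulVec_mulVec, e', dotProduct_smul, e, Complex.ofReal_pow, ← Complex.conj_mul',
      op_smul_eq_mul, mul_comm]
    rfl
  rw [add_mulVec, dotProduct_add, smul_mulVec, smul_mulVec, one_mulVec, dotProduct_smul,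
    dotProduct_smul, sum_mulVec, dotProduct_sum] at h
  simp only [h2] at h
  rw [← h1, ← Complex.ofReal_sum] at h
  -- After 2n steps the barrier is at n/2, so three times the frame matrix of the selected T v
  -- dominates (n/2) · 1; hence the factor 6/n.
  have h3 : (n - 3 / 4 * ((2 * n : ℕ) : ℂ) : ℂ) = ((-(n / 2) : ℝ) : ℂ) := by
    push_cast; ring
  rw [h3, map_add, smul_eq_mul, smul_eq_mul] at h
  simp only [RCLike.re_to_complex, Complex.re_ofReal_mul] at h
  rw [show (3 : ℂ) = ((3 : ℝ) : ℂ) by norm_num, Complex.re_ofReal_mul, Complex.ofReal_re] at h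
  rw [div_mul_eq_mul_div, le_div_iff₀ hn']
  linarith

/-! ### Nearly maximal determinants and control of the sup-norm -/

lemma star_dotProduct_vecMulVec_mulVec {n : ℕ} (u w : Fin n → ℂ) :
    star w ⬝ᵥ vecMulVec u (star u) *ᵥ w = ((‖star w ⬝ᵥ u‖ ^ 2 : ℝ) : ℂ) := by
  have e : star u ⬝ᵥ w = star (star w ⬝ᵥ u) := by rw [star_dotProduct]
  rw [vecMulVec_mulVec, e, dotProduct_smul, Complex.ofReal_pow, ← Complex.conj_mul',
    op_smul_eq_mul, mul_comm]
  rfl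

/-- The frame matrix `∑ i, uᵢ uᵢ*` of a finite family of vectors. -/
def frameMatrix {m n : ℕ} (u : Fin m → Fin n → ℂ) : Matrix (Fin n) (Fin n) ℂ :=
  ∑ i, vecMulVec (u i) (star (u i))

lemma star_dotProduct_frameMatrix_mulVec {m n : ℕ} (u : Fin m → Fin n → ℂ) (w : Fin n → ℂ) :
    star w ⬝ᵥ frameMatrix u *ᵥ w = ((∑ i, ‖star w ⬝ᵥ u i‖ ^ 2 : ℝ) : ℂ) := by
  rw [frameMatrix, sum_mulVec, dotProduct_sum, Complex.ofReal_sum]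
  exact Finset.sum_congr rfl fun i _ => star_dotProduct_vecMulVec_mulVec _ _

lemma posSemidef_frameMatrix {m n : ℕ} (u : Fin m → Fin n → ℂ) : (frameMatrix u).PosSemidef :=
  posSemidef_sum _ fun i _ => posSemidef_vecMulVec_self_star (u i)

lemma posDef_frameMatrix {m n : ℕ} {u : Fin m → Fin n → ℂ}
    (hu : ∀ w : Fin n → ℂ, (∀ i, star w ⬝ᵥ u i = 0) → w = 0) : (frameMatrix u).PosDef := by
  refine PosDef.of_dotProduct_mulVec_pos (posSemidef_frameMatrix u).isHermitian fun w hw => ?_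
  rw [star_dotProduct_frameMatrix_mulVec, Complex.zero_lt_real]
  refine (Finset.sum_nonneg fun i _ => sq_nonneg _).lt_of_ne' fun h => hw (hu w fun i => ?_)
  have := (Finset.sum_eq_zero_iff_of_nonneg fun i _ => sq_nonneg _).1 h i (Finset.mem_univ i)
  simpa using this

lemma det_add_smul_vecMulVec {n : ℕ} {A : Matrix (Fin n) (Fin n) ℂ} (hA : IsUnit A.det)
    (t : ℂ) (u : Fin n → ℂ) :
    (A + t • vecMulVec u (star u)).det = A.det * (1 + t * (star u ⬝ᵥ A⁻¹ *ᵥ u)) := by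
  rw [← smul_vecMulVec, vecMulVec_eq Unit, det_add_replicateCol_mul_replicateRow hA]
  congr 1
  rw [det_unique, Matrix.mul_assoc, ← replicateCol_mulVec, Matrix.add_apply, Matrix.one_apply_eq,
    replicateRow_mul_replicateCol_apply, mulVec_smul, dotProduct_smul, smul_eq_mul]

/-- If no exchange of a vector of the family `u` for `y` increases the determinant of the frame
matrix by more than the factor `3 / 2`, then `y` is small with respect to the frame. -/
lemma norm_dotProduct_sq_le_of_det_le {n : ℕ} (hn : n ≠ 0) {u : Fin (2 * n) → Fin n → ℂ}
    (hu : (frameMatrix u).det ≠ 0) (y : Fin n → ℂ)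
    (hy : ∀ i, ‖(frameMatrix (Function.update u i y)).det‖ ≤ 3 / 2 * ‖(frameMatrix u).det‖)
    (w : Fin n → ℂ) : ‖star w ⬝ᵥ y‖ ^ 2 ≤ 2 * ∑ i, ‖star w ⬝ᵥ u i‖ ^ 2 := by
  have hn' : (0 : ℝ) < n := by exact_mod_cast Nat.pos_of_ne_zero hn
  set G := frameMatrix u with hG
  have hGunit : IsUnit G.det := hu.isUnit
  have hGpos : G.PosDef := (posSemidef_frameMatrix u).posDef_iff_det_ne_zero.2 hu
  set A := G + vecMulVec y (star y) with hA
  have hApos : A.PosDef := hGpos.add_posSemidef (posSemidef_vecMulVec_self_star _)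
  have hAunit : IsUnit A.det := (Matrix.isUnit_iff_isUnit_det A).1 hApos.isUnit
  have hupd : ∀ i, frameMatrix (Function.update u i y) =
      A + (-1 : ℂ) • vecMulVec (u i) (star (u i)) := by
    intro i
    have h1 : frameMatrix (Function.update u i y) = ∑ j, Function.update
        (fun j => vecMulVec (u j) (star (u j))) i (vecMulVec y (star y)) j := by
      refine Finset.sum_congr rfl fun j _ => ?_
      rcases eq_or_ne j i with rfl | hj
      · simp
      · simp [hj]
    rw [h1, Finset.sum_update_of_mem (Finset.mem_univ i), hA, hG, frameMatrix,
      ← Finset.sum_sdiff (Finset.subset_univ {i}), Finset.sum_singleton]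
    module
  -- The leverage scores with respect to A of all 2n + 1 vectors add up to tr 1 = n.
  have htrace : ∑ i, star (u i) ⬝ᵥ A⁻¹ *ᵥ u i = n - star y ⬝ᵥ A⁻¹ *ᵥ y := by
    have h1 : ∀ z : Fin n → ℂ, star z ⬝ᵥ A⁻¹ *ᵥ z = (A⁻¹ * vecMulVec z (star z)).trace := by
      intro z
      rw [mul_vecMulVec, trace_vecMulVec, dotProduct_comm]
    simp only [h1]
    rw [← trace_sum, ← Finset.mul_sum, eq_sub_iff_add_eq, ← trace_add, ← Matrix.mul_add]
    change (A⁻¹ * A).trace = _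
    rw [Matrix.nonsing_inv_mul _ hAunit, trace_one, Fintype.card_fin]
  -- Removing `u i` from A multiplies the determinant by one minus its leverage score. These factors
  -- sum to at least 2n - n = n, while each resulting determinant is at most 3/2 of det G. So det A
  -- is at most 3 det G.
  have hdetA : ‖A.det‖ * n ≤ 2 * n * (3 / 2 * ‖G.det‖) := by
    calc ‖A.det‖ * n ≤ ∑ i : Fin (2 * n), ‖A.det‖ * (1 - (star (u i) ⬝ᵥ A⁻¹ *ᵥ u i).re) := by
          rw [← Finset.mul_sum]
          refine mul_le_mul_of_nonneg_left ?_ (norm_nonneg _)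
          have h1 := congrArg Complex.re htrace
          rw [Complex.re_sum, Complex.sub_re, Complex.natCast_re] at h1
          have h2 : 0 ≤ (star y ⬝ᵥ A⁻¹ *ᵥ y).re :=
            hApos.inv.posSemidef.re_dotProduct_nonneg y
          rw [Finset.sum_sub_distrib, h1]
          simp only [Finset.sum_const, Finset.card_univ, Fintype.card_fin, nsmul_eq_mul]
          push_cast
          linarith
      _ ≤ ∑ i : Fin (2 * n), ‖(frameMatrix (Function.update u i y)).det‖ := by
          refine Finset.sum_le_sum fun i _ => ?_
          rw [hupd, det_add_smul_vecMulVec hAunit, norm_mul]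
          refine mul_le_mul_of_nonneg_left ?_ (norm_nonneg _)
          refine le_trans (le_of_eq ?_) (Complex.re_le_norm _)
          simp [sub_eq_add_neg]
      _ ≤ ∑ i : Fin (2 * n), 3 / 2 * ‖G.det‖ := Finset.sum_le_sum fun i _ => hy i
      _ = _ := by
          simp only [Finset.sum_const, Finset.card_univ, Fintype.card_fin, nsmul_eq_mul]
          push_cast
          ring
  have hGnorm : 0 < ‖G.det‖ := norm_pos_iff.2 hu
  have hh : (star y ⬝ᵥ G⁻¹ *ᵥ y).re ≤ 2 := by
    have h1 := det_add_smul_vecMulVec hGunit 1 y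
    rw [one_smul, one_mul, ← hA] at h1
    rw [h1, norm_mul] at hdetA
    have h2 : 1 + (star y ⬝ᵥ G⁻¹ *ᵥ y).re ≤ ‖1 + star y ⬝ᵥ G⁻¹ *ᵥ y‖ := by
      refine le_trans (le_of_eq ?_) (Complex.re_le_norm _)
      simp
    have h3 : ‖1 + star y ⬝ᵥ G⁻¹ *ᵥ y‖ ≤ 3 := by
      have : (‖G.det‖ * n) * ‖1 + star y ⬝ᵥ G⁻¹ *ᵥ y‖ ≤ (‖G.det‖ * n) * 3 := by linarith
      exact le_of_mul_le_mul_left this (by positivity)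
    linarith
  -- Expand y = G (G⁻¹ y) in the frame; by `hlev` the squared coefficients sum to y* G⁻¹ y ≤ 2, and
  -- Cauchy–Schwarz concludes.
  have hexp : star w ⬝ᵥ y = ∑ i, (star w ⬝ᵥ u i) * star (star (G⁻¹ *ᵥ y) ⬝ᵥ u i) := by
    have h1 : y = G *ᵥ (G⁻¹ *ᵥ y) := by
      rw [mulVec_mulVec, Matrix.mul_nonsing_inv _ hGunit, one_mulVec]
    conv_lhs => rw [h1, hG, frameMatrix, sum_mulVec, dotProduct_sum, ← frameMatrix, ← hG]
    refine Finset.sum_congr rfl fun i _ => ?_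
    have e : star (u i) ⬝ᵥ (G⁻¹ *ᵥ y) = star (star (G⁻¹ *ᵥ y) ⬝ᵥ u i) := by rw [star_dotProduct]
    rw [vecMulVec_mulVec, e, dotProduct_smul, op_smul_eq_mul]
  have hlev : ∑ i, ‖star (G⁻¹ *ᵥ y) ⬝ᵥ u i‖ ^ 2 ≤ 2 := by
    have h1 := star_dotProduct_frameMatrix_mulVec u (G⁻¹ *ᵥ y)
    rw [← hG, mulVec_mulVec, Matrix.mul_nonsing_inv _ hGunit, one_mulVec] at h1
    have h2 : star (G⁻¹ *ᵥ y) ⬝ᵥ y = star y ⬝ᵥ G⁻¹ *ᵥ y := by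
      rw [star_mulVec, ← dotProduct_mulVec, hGpos.inv.isHermitian.eq]
    rw [h2] at h1
    rwa [h1, Complex.ofReal_re] at hh
  calc ‖star w ⬝ᵥ y‖ ^ 2
      ≤ (∑ i, ‖star w ⬝ᵥ u i‖ * ‖star (G⁻¹ *ᵥ y) ⬝ᵥ u i‖) ^ 2 := by
        refine pow_le_pow_left₀ (norm_nonneg _) ?_ 2
        rw [hexp]
        refine (norm_sum_le _ _).trans (Finset.sum_le_sum fun i _ => ?_)
        rw [norm_mul, norm_star]
    _ ≤ (∑ i, ‖star w ⬝ᵥ u i‖ ^ 2) * ∑ i, ‖star (G⁻¹ *ᵥ y) ⬝ᵥ u i‖ ^ 2 :=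
        Finset.sum_mul_sq_le_sq_mul_sq _ _ _
    _ ≤ (∑ i, ‖star w ⬝ᵥ u i‖ ^ 2) * 2 :=
        mul_le_mul_of_nonneg_left hlev (Finset.sum_nonneg fun i _ => sq_nonneg _)
    _ = _ := mul_comm _ _

/-- A separating family spans, since a proper subspace lies in the kernel of a nonzero functional; a
basis is then extracted from it. -/
lemma exists_frame_of_separating {D : Type*} {n : ℕ} {v : D → Fin n → ℂ}
    (hsep : ∀ w : Fin n → ℂ, (∀ x, star w ⬝ᵥ v x = 0) → w = 0) :
    ∃ x : Fin n → D, ∀ w : Fin n → ℂ, (∀ i, star w ⬝ᵥ v (x i) = 0) → w = 0 := by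
  have hspan : Submodule.span ℂ (Set.range v) = ⊤ := by
    by_contra hne
    obtain ⟨f, hf, hle⟩ := Submodule.exists_le_ker_of_lt_top _ (lt_top_iff_ne_top.2 hne)
    apply hf
    have hrep : ∀ z, f z = (fun k => f (Pi.single k 1)) ⬝ᵥ z := by
      intro z
      conv_lhs => rw [pi_eq_sum_univ' z, map_sum]
      refine Finset.sum_congr rfl fun k _ => ?_
      rw [map_smul, smul_eq_mul, mul_comm]
    have h0 : (star fun k => f (Pi.single k 1)) = 0 := by
      apply hsep
      intro x
      rw [star_star, ← hrep]
      exact hle (Submodule.subset_span (Set.mem_range_self x))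
    have h1 : (fun k => f (Pi.single k 1)) = 0 := star_eq_zero.1 h0
    refine LinearMap.ext fun z => ?_
    rw [hrep z, h1, zero_dotProduct, LinearMap.zero_apply]
  have hrank : Module.finrank ℂ (Submodule.span ℂ (Set.range v)) = n := by
    rw [hspan, finrank_top, Module.finrank_fintype_fun_eq_card, Fintype.card_fin]
  obtain ⟨f, hf, hfs, -⟩ := Submodule.exists_fun_fin_finrank_span_eq ℂ (Set.range v)
  choose x hx using hf
  refine ⟨fun i => x (Fin.cast hrank.symm i), fun w hw => hsep w fun y => ?_⟩
  have hle : Submodule.span ℂ (Set.range f) ≤ (dotProductBilin ℂ ℂ (star w)).ker := by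
    rw [Submodule.span_le]
    rintro _ ⟨i, rfl⟩
    have := hw (Fin.cast hrank i)
    rw [← hx i]
    exact this
  have hy : v y ∈ Submodule.span ℂ (Set.range f) := by
    rw [hfs]
    exact Submodule.subset_span (Set.mem_range_self y)
  exact hle hy

/-- A bounded separating family of vectors in `ℂⁿ` contains `2 n` members that control the whole
family: a nearly determinant-maximizing choice works. -/
lemma exists_norm_dotProduct_sq_le {D : Type*} {n : ℕ} (hn : n ≠ 0) {v : D → Fin n → ℂ}
    (hbdd : ∃ M : ℝ, ∀ x k, ‖v x k‖ ≤ M)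
    (hsep : ∀ w : Fin n → ℂ, (∀ x, star w ⬝ᵥ v x = 0) → w = 0) :
    ∃ x : Fin (2 * n) → D, ∀ w y,
      ‖star w ⬝ᵥ v y‖ ^ 2 ≤ 2 * ∑ i, ‖star w ⬝ᵥ v (x i)‖ ^ 2 := by
  obtain ⟨M, hM⟩ := hbdd
  set N : (Fin (2 * n) → D) → ℝ := fun x => ‖(frameMatrix fun i => v (x i)).det‖ with hN
  have hNbdd : BddAbove (Set.range N) := by
    refine ⟨(Fintype.card (Fin n)).factorial • (∑ _i : Fin (2 * n), M * M) ^ Fintype.card (Fin n),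
      ?_⟩
    rintro _ ⟨x, rfl⟩
    refine Matrix.det_le (abv := NormedField.toAbsoluteValue ℂ) fun k l => ?_
    change ‖(frameMatrix fun i => v (x i)) k l‖ ≤ _
    rw [frameMatrix, Matrix.sum_apply]
    refine (norm_sum_le _ _).trans (Finset.sum_le_sum fun i _ => ?_)
    rw [vecMulVec_apply, norm_mul, Pi.star_apply, norm_star]
    exact mul_le_mul (hM _ _) (hM _ _) (norm_nonneg _) ((norm_nonneg _).trans (hM (x i) k))
  obtain ⟨z, hz⟩ := exists_frame_of_separating hsep
  -- Listing a basis twice gives 2n points with nonzero determinant.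
  have hzpos : 0 < N fun i => z ⟨i % n, Nat.mod_lt _ (Nat.pos_of_ne_zero hn)⟩ := by
    rw [hN, norm_pos_iff, ← (posSemidef_frameMatrix _).posDef_iff_det_ne_zero]
    refine posDef_frameMatrix fun w hw => hz w fun i => ?_
    have := hw ⟨i, by omega⟩
    simpa [Nat.mod_eq_of_lt i.2] using this
  have hsup : 0 < ⨆ x, N x := hzpos.trans_le (le_ciSup hNbdd _)
  have : Nonempty (Fin (2 * n) → D) := ⟨fun i => z ⟨i % n, Nat.mod_lt _ (Nat.pos_of_ne_zero hn)⟩⟩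
  -- The supremum need not be attained; reaching 2/3 of it costs only the factor 3/2.
  obtain ⟨x, hx⟩ := exists_lt_of_lt_ciSup (show 2 / 3 * (⨆ x, N x) < ⨆ x, N x by linarith)
  have hmax : ∀ x', N x' ≤ 3 / 2 * N x := fun x' => by
    have := le_ciSup hNbdd x'
    linarith
  have hx0 : 0 < N x := by linarith
  refine ⟨x, fun w y => norm_dotProduct_sq_le_of_det_le hn (norm_pos_iff.1 hx0) (v y) ?_ w⟩
  intro i
  have h1 : Function.update (fun j => v (x j)) i (v y) = fun j => v (Function.update x i y j) := by
    funext j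
    rcases eq_or_ne j i with rfl | hj
    · simp
    · simp [hj]
  rw [h1]
  exact hmax _

/-! ### Least squares, coordinates and the sup-norm on V -/

/-- Discrete least squares: point evaluations that separate a space of functions admit a
reconstruction operator with values in the space which is exact on the space and does not increase
the Euclidean norm of the data. -/
lemma exists_leastSquares {D : Type*} {m : ℕ} {V : Submodule ℂ (D → ℂ)} {x : Fin m → D}
    (hx : ∀ g ∈ V, (∀ i, g (x i) = 0) → g = 0) :
    ∃ φ : Fin m → D → ℂ, (∀ i, φ i ∈ V) ∧ (∀ g ∈ V, ∑ i, g (x i) • φ i = g) ∧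
      ∀ a : Fin m → ℂ, ∑ j, ‖(∑ i, a i • φ i) (x j)‖ ^ 2 ≤ ∑ i, ‖a i‖ ^ 2 := by
  let E : V →ₗ[ℂ] EuclideanSpace ℂ (Fin m) :=
    { toFun := fun g => WithLp.toLp 2 fun i => (g : D → ℂ) (x i)
      map_add' := fun _ _ => rfl
      map_smul' := fun _ _ => rfl }
  have hE : Function.Injective E := by
    rw [injective_iff_map_eq_zero]
    rintro ⟨g, hg⟩ h
    refine Subtype.ext (hx g hg fun i => ?_)
    exact congrArg (fun z : EuclideanSpace ℂ (Fin m) => z i) h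
  -- Project the data orthogonally onto the sampled values of V, then invert sampling there.
  let A : EuclideanSpace ℂ (Fin m) →ₗ[ℂ] V :=
    (LinearEquiv.ofInjective E hE).symm.toLinearMap ∘ₗ
      (LinearMap.range E).orthogonalProjectionOnto.toLinearMap
  have hEA : ∀ z, E (A z) = (LinearMap.range E).orthogonalProjectionOnto z := fun z =>
    congrArg Subtype.val ((LinearEquiv.ofInjective E hE).apply_symm_apply _)
  have hAE : ∀ g, A (E g) = g := fun g => by
    apply hE
    rw [hEA]
    exact congrArg Subtype.val (Submodule.orthogonalProjectionOnto_mem_subspace_eq_self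
      (⟨E g, LinearMap.mem_range_self E g⟩ : LinearMap.range E))
  have hsum : ∀ a : Fin m → ℂ,
      ∑ i, a i • (A (EuclideanSpace.single i 1) : D → ℂ) = (A (WithLp.toLp 2 a) : D → ℂ) := by
    intro a
    have h1 : (WithLp.toLp 2 a : EuclideanSpace ℂ (Fin m)) =
        ∑ i, a i • EuclideanSpace.single i (1 : ℂ) := by
      ext j
      simp [Pi.single_apply]
    rw [h1, map_sum, Submodule.coe_sum]
    refine Finset.sum_congr rfl fun i _ => ?_
    rw [map_smul, Submodule.coe_smul]
  refine ⟨fun i => (A (EuclideanSpace.single i 1) : D → ℂ), fun i => Subtype.coe_prop _, ?_, ?_⟩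
  · intro g hg
    rw [hsum fun i => g (x i)]
    exact congrArg Subtype.val (hAE ⟨g, hg⟩)
  · intro a
    rw [hsum a]
    have h1 := Submodule.norm_orthogonalProjectionOnto_apply_le (LinearMap.range E)
      (WithLp.toLp 2 a)
    have h2 : ‖E (A (WithLp.toLp 2 a))‖ ≤ ‖(WithLp.toLp 2 a : EuclideanSpace ℂ (Fin m))‖ := by
      rw [hEA]
      exact h1
    have h3 := pow_le_pow_left₀ (norm_nonneg _) h2 2
    rw [EuclideanSpace.norm_sq_eq, EuclideanSpace.norm_sq_eq] at h3
    exact h3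

lemma exists_coordinates {D : Type*} {n : ℕ} {V : Submodule ℂ (D → ℂ)} [FiniteDimensional ℂ V]
    (hV : Module.finrank ℂ V = n) :
    ∃ v : D → Fin n → ℂ, (∀ k, (fun x => v x k) ∈ V) ∧
      (∀ g ∈ V, ∃ w : Fin n → ℂ, ∀ x, g x = star w ⬝ᵥ v x) ∧
      ∀ w : Fin n → ℂ, (∀ x, star w ⬝ᵥ v x = 0) → w = 0 := by
  let b := Module.finBasisOfFinrankEq ℂ V hV
  refine ⟨fun x k => (b k : D → ℂ) x, fun k => (b k).2, fun g hg => ?_, fun w hw => ?_⟩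
  · refine ⟨star fun k => b.repr ⟨g, hg⟩ k, fun x => ?_⟩
    have h1 := congrArg (fun z : V => (z : D → ℂ) x) (b.sum_repr ⟨g, hg⟩)
    simp only [Submodule.coe_sum, Submodule.coe_smul, Finset.sum_apply, Pi.smul_apply,
      smul_eq_mul] at h1
    rw [star_star, dotProduct]
    exact h1.symm
  · have h1 : ∑ k, star (w k) • b k = 0 := by
      refine Subtype.ext (funext fun x => ?_)
      simp only [Submodule.coe_sum, Submodule.coe_smul, Finset.sum_apply, Pi.smul_apply,
        smul_eq_mul]
      exact hw x
    funext k
    exact star_eq_zero.1 (Fintype.linearIndependent_iff.1 b.linearIndependent _ h1 k)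

lemma exists_bound_coordinates {D : Type*} {n : ℕ} {v : D → Fin n → ℂ}
    (hv : ∀ k, (fun x => v x k) ∈ boundedFunctions D) : ∃ M : ℝ, ∀ x k, ‖v x k‖ ≤ M := by
  choose M hM using hv
  refine ⟨∑ k, |M k|, fun x k => ((hM k x).trans (le_abs_self _)).trans ?_⟩
  exact Finset.single_le_sum (f := fun k => |M k|) (fun _ _ => abs_nonneg _) (Finset.mem_univ k)

/-- On an `n`-dimensional space of bounded functions the sup-norm is controlled by the Euclidean
norm of the values at `2 n` points. -/
lemma exists_norm_sq_le_sum {D : Type*} {n : ℕ} (hn : n ≠ 0) {V : Submodule ℂ (D → ℂ)}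
    [FiniteDimensional ℂ V] (hV : Module.finrank ℂ V = n) (hVb : V ≤ boundedFunctions D) :
    ∃ x : Fin (2 * n) → D, ∀ g ∈ V, ∀ y, ‖g y‖ ^ 2 ≤ 2 * ∑ i, ‖g (x i)‖ ^ 2 := by
  obtain ⟨v, hvV, hrep, hsep⟩ := exists_coordinates hV
  obtain ⟨x, hx⟩ := exists_norm_dotProduct_sq_le hn
    (exists_bound_coordinates fun k => hVb (hvV k)) hsep
  refine ⟨x, fun g hg y => ?_⟩
  obtain ⟨w, hw⟩ := hrep g hg
  simp only [hw]
  exact hx w y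

/-! ### Second moments and simultaneous control of sup-norm and L₂-norm -/

lemma trace_frameMatrix_mul {m n : ℕ} (u : Fin m → Fin n → ℂ) (P : Matrix (Fin n) (Fin n) ℂ) :
    (frameMatrix u * P).trace = ∑ i, star (u i) ⬝ᵥ P *ᵥ u i := by
  rw [frameMatrix, Finset.sum_mul, trace_sum]
  refine Finset.sum_congr rfl fun i _ => ?_
  rw [vecMulVec_mul, trace_vecMulVec, dotProduct_comm, ← dotProduct_mulVec]

section moment

variable {D : Type*} [MeasurableSpace D] {n : ℕ}

/-- The second moment matrix `∫ v v* ∂μ`. -/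
noncomputable def momentMatrix (μ : Measure D) (v : D → Fin n → ℂ) :
    Matrix (Fin n) (Fin n) ℂ :=
  Matrix.of fun k l => ∫ x, v x k * star (v x l) ∂μ

lemma isHermitian_momentMatrix (μ : Measure D) (v : D → Fin n → ℂ) :
    (momentMatrix μ v).IsHermitian := by
  ext k l
  simp only [momentMatrix, conjTranspose_apply, Matrix.of_apply]
  rw [RCLike.star_def, ← integral_conj]
  refine integral_congr_ae (Filter.Eventually.of_forall fun x => ?_)
  simp [mul_comm]

lemma trace_momentMatrix_mul {μ : Measure D} {v : D → Fin n → ℂ}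
    (hv : ∀ k l, Integrable (fun x => v x k * star (v x l)) μ) (P : Matrix (Fin n) (Fin n) ℂ) :
    Integrable (fun x => star (v x) ⬝ᵥ P *ᵥ v x) μ ∧
      (momentMatrix μ v * P).trace = ∫ x, star (v x) ⬝ᵥ P *ᵥ v x ∂μ := by
  have h1 : (fun x => star (v x) ⬝ᵥ P *ᵥ v x) =
      fun x => ∑ k, ∑ l, (v x k * star (v x l)) * P l k := by
    funext x
    rw [Finset.sum_comm]
    refine Finset.sum_congr rfl fun l _ => ?_
    rw [mulVec, dotProduct, Finset.mul_sum]
    refine Finset.sum_congr rfl fun k _ => ?_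
    rw [Pi.star_apply]
    ring
  have h2 : ∀ k l, Integrable (fun x => (v x k * star (v x l)) * P l k) μ :=
    fun k l => (hv k l).mul_const _
  rw [h1]
  refine ⟨integrable_finsetSum _ fun k _ => integrable_finsetSum _ fun l _ => h2 k l, ?_⟩
  rw [integral_finsetSum _ fun k _ => integrable_finsetSum _ fun l _ => h2 k l]
  refine Finset.sum_congr rfl fun k _ => ?_
  rw [integral_finsetSum _ fun l _ => h2 k l, diag_apply, Matrix.mul_apply]
  refine Finset.sum_congr rfl fun l _ => ?_
  rw [integral_mul_const]
  rfl

lemma star_dotProduct_momentMatrix_mulVec {μ : Measure D} {v : D → Fin n → ℂ}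
    (hv : ∀ k l, Integrable (fun x => v x k * star (v x l)) μ) (w : Fin n → ℂ) :
    star w ⬝ᵥ momentMatrix μ v *ᵥ w = ((∫ x, ‖star w ⬝ᵥ v x‖ ^ 2 ∂μ : ℝ) : ℂ) := by
  have h1 := (trace_momentMatrix_mul hv (vecMulVec w (star w))).2
  rw [mul_vecMulVec, trace_vecMulVec, dotProduct_comm] at h1
  rw [h1, ← integral_complex_ofReal]
  refine integral_congr_ae (Filter.Eventually.of_forall fun x => ?_)
  simp only
  rw [star_dotProduct_vecMulVec_mulVec, star_dotProduct, norm_star]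

/-- On an `n`-dimensional space of bounded measurable functions both the sup-norm and the
`L₂`-norm are controlled, with the right scaling, by the values at the same `2 n` points. -/
lemma exists_norm_sq_le_sum_and_integral_le_sum {μ : Measure D} [IsProbabilityMeasure μ]
    (hn : n ≠ 0) {V : Submodule ℂ (D → ℂ)} [FiniteDimensional ℂ V]
    (hV : Module.finrank ℂ V = n) (hVb : V ≤ boundedMeasurableFunctions μ) :
    ∃ x : Fin (2 * n) → D, ∀ g ∈ V,
      (∀ y, ‖g y‖ ^ 2 ≤ 48 * ∑ i, ‖g (x i)‖ ^ 2) ∧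
        ∫ y, ‖g y‖ ^ 2 ∂μ ≤ 12 / n * ∑ i, ‖g (x i)‖ ^ 2 := by
  have hn' : (0 : ℝ) < n := by exact_mod_cast Nat.pos_of_ne_zero hn
  obtain ⟨v, hvV, hrep, hsep⟩ := exists_coordinates hV
  obtain ⟨K, hK⟩ := exists_bound_coordinates fun k => (hVb (hvV k)).1
  obtain ⟨y, hy⟩ := exists_norm_dotProduct_sq_le hn ⟨K, hK⟩ hsep
  have hint : ∀ k l, Integrable (fun x => v x k * star (v x l)) μ := by
    intro k l
    refine Integrable.of_bound (C := K * K) ?_ (Filter.Eventually.of_forall fun x => ?_)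
    · exact (hVb (hvV k)).2.aestronglyMeasurable.mul (hVb (hvV l)).2.aestronglyMeasurable.star
    · rw [norm_mul, norm_star]
      exact mul_le_mul (hK _ _) (hK _ _) (norm_nonneg _) ((norm_nonneg _).trans (hK x k))
  set u : Fin (2 * n) → Fin n → ℂ := fun i => v (y i) with hu
  -- Second moment matrix of the mixture; each of the 2n points `y i` carries mass 1/(4n).
  set M : Matrix (Fin n) (Fin n) ℂ := ((1 / 2 : ℝ) : ℂ) • momentMatrix μ v +
    ((1 / (4 * n) : ℝ) : ℂ) • frameMatrix u with hMdef
  have hMq : ∀ w : Fin n → ℂ, star w ⬝ᵥ M *ᵥ w =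
      ((1 / 2 * ∫ x, ‖star w ⬝ᵥ v x‖ ^ 2 ∂μ + 1 / (4 * n) * ∑ i, ‖star w ⬝ᵥ u i‖ ^ 2 : ℝ) : ℂ) := by
    intro w
    rw [hMdef, add_mulVec, dotProduct_add, smul_mulVec, smul_mulVec, dotProduct_smul,
      dotProduct_smul, star_dotProduct_momentMatrix_mulVec hint,
      star_dotProduct_frameMatrix_mulVec, smul_eq_mul, smul_eq_mul, Complex.ofReal_add,
      Complex.ofReal_mul, Complex.ofReal_mul]
  have hIpos : ∀ w : Fin n → ℂ, 0 ≤ ∫ x, ‖star w ⬝ᵥ v x‖ ^ 2 ∂μ := fun w =>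
    integral_nonneg fun x => sq_nonneg _
  -- The discrete half ensures definiteness even if a nonzero element of V vanishes μ-almost
  -- everywhere.
  have hMpos : M.PosDef := by
    refine PosDef.of_dotProduct_mulVec_pos ?_ fun w hw => ?_
    · refine IsHermitian.add ?_ ?_
      · rw [IsHermitian, conjTranspose_smul, (isHermitian_momentMatrix μ v).eq]
        congr 1
        exact Complex.conj_ofReal _
      · rw [IsHermitian, conjTranspose_smul, (posSemidef_frameMatrix u).isHermitian.eq]
        congr 1
        exact Complex.conj_ofReal _
    · rw [hMq, Complex.zero_lt_real]
      have h1 : 0 < ∑ i, ‖star w ⬝ᵥ u i‖ ^ 2 := by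
        refine (Finset.sum_nonneg fun i _ => sq_nonneg _).lt_of_ne' fun h0 => hw (hsep w fun x => ?_)
        have h2 := hy w x
        have h3 : ∑ i, ‖star w ⬝ᵥ v (y i)‖ ^ 2 = 0 := h0
        rw [h3, mul_zero] at h2
        simpa using le_antisymm h2 (sq_nonneg _)
      have := hIpos w
      positivity
  -- If the form were below its mean τ everywhere, so would be its mean; strictness comes from the
  -- discrete half.
  have hatt : AttainsTrace v M := by
    intro P _
    by_contra! hlt
    set τ := (M * P).trace.re with hτ
    obtain ⟨hi, htr⟩ := trace_momentMatrix_mul hint P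
    have hτ' : τ = 1 / 2 * ∫ x, (star (v x) ⬝ᵥ P *ᵥ v x).re ∂μ +
        1 / (4 * n) * ∑ i, (star (u i) ⬝ᵥ P *ᵥ u i).re := by
      rw [hτ, hMdef, Matrix.add_mul, Matrix.smul_mul, Matrix.smul_mul, trace_add, trace_smul,
        trace_smul, htr, trace_frameMatrix_mul, Complex.add_re, smul_eq_mul, smul_eq_mul,
        Complex.re_ofReal_mul, Complex.re_ofReal_mul, Complex.re_sum]
      congr 2
      exact (integral_re hi).symm
    have h1 : ∫ x, (star (v x) ⬝ᵥ P *ᵥ v x).re ∂μ ≤ τ := by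
      have h2 : ∫ x, (star (v x) ⬝ᵥ P *ᵥ v x).re ∂μ ≤ ∫ _, τ ∂μ :=
        integral_mono hi.re (integrable_const _) fun x => (hlt x).le
      simpa using h2
    have h2 : ∑ i, (star (u i) ⬝ᵥ P *ᵥ u i).re < 2 * n * τ := by
      have : ∑ i, (star (u i) ⬝ᵥ P *ᵥ u i).re < ∑ _i : Fin (2 * n), τ := by
        refine Finset.sum_lt_sum_of_nonempty ⟨⟨0, by omega⟩, Finset.mem_univ _⟩ fun i _ => hlt _
      simpa using this
    have h3 : 1 / (4 * n) * ∑ i, (star (u i) ⬝ᵥ P *ᵥ u i).re < 1 / (4 * n) * (2 * n * τ) :=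
      mul_lt_mul_of_pos_left h2 (by positivity)
    have h4 : (1 : ℝ) / (4 * n) * (2 * n * τ) = 1 / 2 * τ := by field_simp; ring
    linarith
  obtain ⟨x, hx⟩ := hatt.exists_le_sum hn hMpos
  refine ⟨x, fun g hg => ?_⟩
  obtain ⟨w, hw⟩ := hrep g hg
  have h1 := hx w
  rw [hMq, Complex.ofReal_re] at h1
  have h2 := hIpos w
  have h3 : 0 ≤ ∑ i, ‖star w ⬝ᵥ u i‖ ^ 2 := Finset.sum_nonneg fun i _ => sq_nonneg _
  simp only [hw]
  constructor
  · intro z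
    have h4 : 1 / (4 * n) * ∑ i, ‖star w ⬝ᵥ u i‖ ^ 2 ≤ 6 / n * ∑ i, ‖star w ⬝ᵥ v (x i)‖ ^ 2 := by
      linarith
    have h5 : ∑ i, ‖star w ⬝ᵥ u i‖ ^ 2 ≤ 24 * ∑ i, ‖star w ⬝ᵥ v (x i)‖ ^ 2 := by
      have h6 := mul_le_mul_of_nonneg_left h4 (show (0 : ℝ) ≤ 4 * n by positivity)
      field_simp at h6
      linarith
    have h7 : ‖star w ⬝ᵥ v z‖ ^ 2 ≤ 2 * ∑ i, ‖star w ⬝ᵥ u i‖ ^ 2 := hy w z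
    linarith
  · have h4 : 1 / 2 * ∫ z, ‖star w ⬝ᵥ v z‖ ^ 2 ∂μ ≤ 6 / n * ∑ i, ‖star w ⬝ᵥ v (x i)‖ ^ 2 := by
      have : 0 ≤ 1 / (4 * n) * ∑ i, ‖star w ⬝ᵥ u i‖ ^ 2 := by positivity
      linarith
    have h5 : (12 : ℝ) / n = 2 * (6 / n) := by ring
    rw [h5]
    linarith

end moment

/-! ### From reconstruction operators to sampling numbers -/

lemma linSamplingNumber_add_self_le {D : Type*} (m : ℕ) (F : Set (D → ℂ))
    (G : Submodule ℂ (D → ℂ)) (N : (D → ℂ) → ℝ≥0∞) :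
    linSamplingNumber (m + m) F G N ≤ linSamplingNumber m F G N := by
  refine le_iInf fun x => le_iInf fun φ => le_iInf fun hφ => ?_
  -- Repeat the points, with zero functions attached to the copies.
  refine iInf_le_of_le (Fin.append x x) (iInf_le_of_le (Fin.append φ fun _ => 0)
    (iInf_le_of_le ?_ (le_of_eq ?_)))
  · intro i
    refine Fin.addCases (fun j => ?_) (fun j => ?_) i
    · rw [Fin.append_left]
      exact hφ j
    · rw [Fin.append_right]
      exact zero_mem G
  · simp [Fin.sum_univ_add, -Fin.natAdd_eq_addNat]

lemma linSamplingNumber_le_mul_kolmogorovNumber {D : Type*} {m n : ℕ} {F : Set (D → ℂ)}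
    {G H : Submodule ℂ (D → ℂ)} {N : (D → ℂ) → ℝ≥0∞} {K : ℝ≥0∞} (hK : K ≠ 0) (hK' : K ≠ ⊤)
    (h : ∀ V : Submodule ℂ (D → ℂ), V ≤ H → FiniteDimensional ℂ V → Module.finrank ℂ V = n →
      ∃ (x : Fin m → D) (φ : Fin m → D → ℂ), (∀ i, φ i ∈ G) ∧
        ∀ f ∈ F, ∀ g ∈ V, N (f - ∑ i, f (x i) • φ i) ≤ K * supNorm (f - g)) :
    linSamplingNumber m F G N ≤ K * kolmogorovNumber n F H supNorm := by
  rw [kolmogorovNumber]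
  simp only [ENNReal.mul_iInf_of_ne hK hK']
  refine le_iInf fun V => le_iInf fun hVH => le_iInf fun hV => le_iInf fun hVn => ?_
  obtain ⟨x, φ, hφ, hxφ⟩ := h V hVH hV hVn
  refine iInf_le_of_le x (iInf_le_of_le φ (iInf_le_of_le hφ (iSup₂_le fun f hf => ?_)))
  calc N (f - ∑ i, f (x i) • φ i) ≤ K * ⨅ g ∈ V, supNorm (f - g) := by
        simp only [ENNReal.mul_iInf_of_ne hK hK']
        exact le_iInf₂ fun g hg => hxφ f hf g hg
    _ ≤ _ := by
        gcongr
        exact le_iSup₂ (f := fun f (_ : f ∈ F) => ⨅ g ∈ V, supNorm (f - g)) f hf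

lemma exists_supNorm_eq_ofReal {D : Type*} {e : D → ℂ} (he : e ∈ boundedFunctions D) :
    ∃ s : ℝ, 0 ≤ s ∧ supNorm e = ENNReal.ofReal s ∧ ∀ x, ‖e x‖ ≤ s := by
  obtain ⟨M, hM⟩ := he
  have hfin : supNorm e ≠ ⊤ := by
    refine ne_top_of_le_ne_top (ENNReal.ofReal_ne_top (r := M)) (iSup_le fun x => ?_)
    rw [← ofReal_norm]
    exact ENNReal.ofReal_le_ofReal (hM x)
  refine ⟨(supNorm e).toReal, ENNReal.toReal_nonneg, (ENNReal.ofReal_toReal hfin).symm,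
    fun x => ?_⟩
  rw [← toReal_enorm]
  exact ENNReal.toReal_mono hfin (le_iSup (fun x => ‖e x‖ₑ) x)

lemma supNorm_le_ofReal {D : Type*} {e : D → ℂ} {s : ℝ} (he : ∀ x, ‖e x‖ ≤ s) :
    supNorm e ≤ ENNReal.ofReal s := by
  refine iSup_le fun x => ?_
  rw [← ofReal_norm]
  exact ENNReal.ofReal_le_ofReal (he x)

lemma sub_sum_smul_eq {D : Type*} {m : ℕ} {V : Submodule ℂ (D → ℂ)} {x : Fin m → D}
    {φ : Fin m → D → ℂ} (hφ : ∀ g ∈ V, ∑ i, g (x i) • φ i = g) (f : D → ℂ) {g : D → ℂ}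
    (hg : g ∈ V) : f - ∑ i, f (x i) • φ i = (f - g) - ∑ i, (f - g) (x i) • φ i := by
  simp only [Pi.sub_apply, sub_smul, Finset.sum_sub_distrib, hφ g hg]
  abel

/-- Interpolation between `L₂` and the sup-norm. -/
lemma eLpNorm_le_of_sq_le_of_integral_sq_le {D : Type*} [MeasurableSpace D] {μ : Measure D}
    [IsProbabilityMeasure μ] {h : D → ℂ} (hm : AEStronglyMeasurable h μ) {a N : ℝ} (ha : 0 ≤ a)
    (hN : 1 ≤ N) (hsup : ∀ y, ‖h y‖ ^ 2 ≤ a ^ 2 * N) (hint : ∫ y, ‖h y‖ ^ 2 ∂μ ≤ a ^ 2)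
    (p : ℝ≥0∞) :
    eLpNorm h p μ ≤ ENNReal.ofReal (a * N ^ max (1 / 2 - (p⁻¹).toReal) 0) := by
  rcases ha.eq_or_lt with rfl | ha
  · have h0 : h = 0 := by
      funext y
      have := hsup y
      rw [zero_pow two_ne_zero, zero_mul] at this
      simpa using le_antisymm this (sq_nonneg _)
    simp [h0]
  have hN0 : 0 < N := by linarith
  have hbound : ∀ y, ‖h y‖ ≤ a * √N := fun y => by
    refine le_of_sq_le_sq ?_ (by positivity)
    rw [mul_pow, Real.sq_sqrt hN0.le]
    exact hsup y
  have hmem : ∀ q : ℝ≥0∞, MemLp h q μ := fun q =>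
    MemLp.of_bound hm (a * √N) (Filter.Eventually.of_forall hbound)
  rcases le_total p 2 with hp | hp
  · refine (eLpNorm_le_eLpNorm_of_exponent_le hp hm).trans ?_
    rw [(hmem 2).eLpNorm_eq_integral_rpow_norm two_ne_zero ENNReal.ofNat_ne_top]
    apply ENNReal.ofReal_le_ofReal
    have h1 : (∫ y, ‖h y‖ ^ (2 : ℝ≥0∞).toReal ∂μ) ^ ((2 : ℝ≥0∞).toReal)⁻¹ ≤ a := by
      simp only [ENNReal.toReal_ofNat, Real.rpow_ofNat]
      calc (∫ y, ‖h y‖ ^ 2 ∂μ) ^ ((2 : ℝ)⁻¹) ≤ (a ^ 2) ^ ((2 : ℝ)⁻¹) :=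
            Real.rpow_le_rpow (integral_nonneg fun y => sq_nonneg _) hint (by norm_num)
        _ = a := by
            rw [← Real.rpow_ofNat, ← Real.rpow_mul ha.le]
            norm_num
    refine h1.trans (le_mul_of_one_le_right ha.le ?_)
    exact Real.one_le_rpow hN (le_max_right _ _)
  · rcases eq_or_ne p ⊤ with rfl | hp'
    · refine (eLpNorm_le_of_ae_bound (Filter.Eventually.of_forall hbound)).trans ?_
      simp [Real.sqrt_eq_rpow]
    · have hp0 : p ≠ 0 := (lt_of_lt_of_le two_pos hp).ne'
      set q := p.toReal with hq
      have hq2 : 2 ≤ q := by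
        rw [hq, ← ENNReal.toReal_ofNat]
        exact ENNReal.toReal_mono hp' hp
      have hq0 : 0 < q := by linarith
      rw [(hmem p).eLpNorm_eq_integral_rpow_norm hp0 hp']
      apply ENNReal.ofReal_le_ofReal
      have h2 : Integrable (fun y => ‖h y‖ ^ 2) μ := (hmem 2).integrable_norm_pow two_ne_zero
      -- Split |h|^q = |h|^(q-2) |h|², bounding the first factor uniformly and integrating the
      -- second.
      have hI : ∫ y, ‖h y‖ ^ q ∂μ ≤ (a * √N) ^ (q - 2) * a ^ 2 := by
        calc ∫ y, ‖h y‖ ^ q ∂μ ≤ ∫ y, (a * √N) ^ (q - 2) * ‖h y‖ ^ 2 ∂μ := by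
              refine integral_mono ((hmem p).integrable_norm_rpow hp0 hp') (h2.const_mul _)
                fun y => ?_
              have h3 : ‖h y‖ ^ q = ‖h y‖ ^ (q - 2) * ‖h y‖ ^ 2 := by
                rw [← Real.rpow_ofNat, ← Real.rpow_add_of_nonneg (norm_nonneg _) (by linarith)
                  (by norm_num)]
                congr 1
                ring
              simp only
              rw [h3]
              exact mul_le_mul_of_nonneg_right
                (Real.rpow_le_rpow (norm_nonneg _) (hbound y) (by linarith)) (sq_nonneg _)
          _ = (a * √N) ^ (q - 2) * ∫ y, ‖h y‖ ^ 2 ∂μ := integral_const_mul _ _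
          _ ≤ _ := mul_le_mul_of_nonneg_left hint (by positivity)
      have hmax : max (1 / 2 - (p⁻¹).toReal) 0 = 1 / 2 - q⁻¹ := by
        rw [ENNReal.toReal_inv, max_eq_left]
        have : q⁻¹ ≤ 2⁻¹ := inv_anti₀ two_pos hq2
        linarith
      rw [hmax]
      calc (∫ y, ‖h y‖ ^ q ∂μ) ^ q⁻¹ ≤ ((a * √N) ^ (q - 2) * a ^ 2) ^ q⁻¹ :=
            Real.rpow_le_rpow (integral_nonneg fun y => by positivity) hI (by positivity)
        _ = (a ^ q * N ^ (1 / 2 * (q - 2))) ^ q⁻¹ := by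
            congr 1
            rw [Real.mul_rpow ha.le (Real.sqrt_nonneg _), Real.sqrt_eq_rpow,
              ← Real.rpow_mul hN0.le, mul_right_comm, ← Real.rpow_ofNat, ← Real.rpow_add ha]
            congr 2
            ring
        _ = a * N ^ (1 / 2 - q⁻¹) := by
            rw [Real.mul_rpow (by positivity) (by positivity), ← Real.rpow_mul ha.le,
              ← Real.rpow_mul hN0.le, mul_inv_cancel₀ hq0.ne', Real.rpow_one]
            congr 2
            field_simp

lemma linSamplingNumber_boundedFunctions_le {D : Type*} {F : Set (D → ℂ)}
    (hF : F ⊆ boundedFunctions D) {n : ℕ} (hn : 1 ≤ n) :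
    linSamplingNumber (2 * n) F (boundedFunctions D) supNorm ≤
      ENNReal.ofReal (3 * √(n : ℝ)) * kolmogorovNumber n F (boundedFunctions D) supNorm := by
  have hn' : (1 : ℝ) ≤ n := by exact_mod_cast hn
  have hsqrt : 1 ≤ √(n : ℝ) := Real.one_le_sqrt.2 hn'
  refine linSamplingNumber_le_mul_kolmogorovNumber
    (ENNReal.ofReal_pos.2 (by positivity)).ne' ENNReal.ofReal_ne_top fun V hVb hV hVn => ?_
  obtain ⟨x, hx⟩ := exists_norm_sq_le_sum (by omega) hVn hVb
  obtain ⟨φ, hφV, hφ, hφn⟩ := exists_leastSquares (V := V) (x := x) fun g hg h0 => by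
    funext y
    have := hx g hg y
    simp only [h0, norm_zero, ne_eq, OfNat.ofNat_ne_zero, not_false_eq_true, zero_pow,
      Finset.sum_const_zero, mul_zero] at this
    simpa using le_antisymm this (sq_nonneg _)
  refine ⟨x, φ, fun i => hVb (hφV i), fun f hf g hg => ?_⟩
  obtain ⟨s, hs, hes, hle⟩ := exists_supNorm_eq_ofReal (sub_mem (hF hf) (hVb hg))
  rw [sub_sum_smul_eq hφ f hg, hes, ← ENNReal.ofReal_mul (by positivity)]
  refine supNorm_le_ofReal fun y => ?_
  have hV' : ∑ i, (f - g) (x i) • φ i ∈ V :=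
    Submodule.sum_mem _ fun i _ => Submodule.smul_mem _ _ (hφV i)
  -- The square is at most 2 · 2n s² by the sup-norm bound on V and the least squares contraction.
  have h1 : ‖(∑ i, (f - g) (x i) • φ i) y‖ ≤ 2 * √(n : ℝ) * s := by
    refine le_of_sq_le_sq ?_ (by positivity)
    have h2 : ∑ i, ‖(f - g) (x i)‖ ^ 2 ≤ ∑ _i : Fin (2 * n), s ^ 2 :=
      Finset.sum_le_sum fun i _ => pow_le_pow_left₀ (norm_nonneg _) (hle _) 2
    have h3 := hx _ hV' y
    have h4 := hφn fun i => (f - g) (x i)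
    simp only [Finset.sum_const, Finset.card_univ, Fintype.card_fin, nsmul_eq_mul] at h2
    push_cast at h2
    rw [mul_pow, mul_pow, Real.sq_sqrt (by positivity)]
    linarith
  calc ‖((f - g) - ∑ i, (f - g) (x i) • φ i) y‖
      ≤ ‖(f - g) y‖ + ‖(∑ i, (f - g) (x i) • φ i) y‖ := norm_sub_le _ _
    _ ≤ s + 2 * √(n : ℝ) * s := add_le_add (hle y) h1
    _ ≤ 3 * √(n : ℝ) * s := by nlinarith

lemma boundedMeasurableFunctions_le_lpFunctions {D : Type*} [MeasurableSpace D] (μ : Measure D)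
    [IsFiniteMeasure μ] (p : ℝ≥0∞) : boundedMeasurableFunctions μ ≤ lpFunctions p μ := by
  rintro f ⟨⟨M, hM⟩, hf⟩
  exact MemLp.of_bound hf.aestronglyMeasurable M (Filter.Eventually.of_forall hM)

lemma linSamplingNumber_lpFunctions_le {D : Type*} [MeasurableSpace D] {μ : Measure D}
    [IsProbabilityMeasure μ] {F : Set (D → ℂ)} (hF : F ⊆ boundedMeasurableFunctions μ) {n : ℕ}
    (hn : 1 ≤ n) {p : ℝ≥0∞} (hp : 1 ≤ p) :
    linSamplingNumber (2 * n) F (lpFunctions p μ) (fun f => eLpNorm f p μ) ≤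
      ENNReal.ofReal (11 * (n : ℝ) ^ max (1 / 2 - (p⁻¹).toReal) 0) *
        kolmogorovNumber n F (boundedMeasurableFunctions μ) supNorm := by
  have hn' : (1 : ℝ) ≤ n := by exact_mod_cast hn
  set c := (n : ℝ) ^ max (1 / 2 - (p⁻¹).toReal) 0 with hc
  have hc1 : 1 ≤ c := Real.one_le_rpow hn' (le_max_right _ _)
  refine linSamplingNumber_le_mul_kolmogorovNumber
    (ENNReal.ofReal_pos.2 (by positivity)).ne' ENNReal.ofReal_ne_top fun V hVb hV hVn => ?_
  obtain ⟨x, hx⟩ := exists_norm_sq_le_sum_and_integral_le_sum (by omega) hVn hVb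
  obtain ⟨φ, hφV, hφ, hφn⟩ := exists_leastSquares (V := V) (x := x) fun g hg h0 => by
    funext y
    have := (hx g hg).1 y
    simp only [h0, norm_zero, ne_eq, OfNat.ofNat_ne_zero, not_false_eq_true, zero_pow,
      Finset.sum_const_zero, mul_zero] at this
    simpa using le_antisymm this (sq_nonneg _)
  refine ⟨x, φ, fun i => boundedMeasurableFunctions_le_lpFunctions μ p (hVb (hφV i)),
    fun f hf g hg => ?_⟩
  have he : f - g ∈ boundedMeasurableFunctions μ := sub_mem (hF hf) (hVb hg)
  obtain ⟨s, hs, hes, hle⟩ := exists_supNorm_eq_ofReal he.1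
  rw [sub_sum_smul_eq hφ f hg, hes, ← ENNReal.ofReal_mul (by positivity)]
  set r := ∑ i, (f - g) (x i) • φ i with hr
  have hV' : r ∈ V := Submodule.sum_mem _ fun i _ => Submodule.smul_mem _ _ (hφV i)
  have hrm : AEStronglyMeasurable r μ := (hVb hV').2.aestronglyMeasurable
  have hsum : ∑ i, ‖r (x i)‖ ^ 2 ≤ 2 * n * s ^ 2 := by
    refine (hφn fun i => (f - g) (x i)).trans ?_
    have h2 : ∑ i, ‖(f - g) (x i)‖ ^ 2 ≤ ∑ _i : Fin (2 * n), s ^ 2 :=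
      Finset.sum_le_sum fun i _ => pow_le_pow_left₀ (norm_nonneg _) (hle _) 2
    simp only [Finset.sum_const, Finset.card_univ, Fintype.card_fin, nsmul_eq_mul] at h2
    push_cast at h2
    exact h2
  -- The sup bound gives 48 · 2n s² = 96 n s² and the L₂ bound 24 s²; both fit a = 10 s and N = n.
  have hr1 : eLpNorm r p μ ≤ ENNReal.ofReal (10 * s * c) := by
    refine eLpNorm_le_of_sq_le_of_integral_sq_le hrm (by positivity) hn' (fun y => ?_) ?_ p
    · have h1 := (hx r hV').1 y
      nlinarith [mul_nonneg (zero_le_one.trans hn') (sq_nonneg s)]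
    · refine (hx r hV').2.trans ?_
      have h1 : 12 / (n : ℝ) * ∑ i, ‖r (x i)‖ ^ 2 ≤ 12 / n * (2 * n * s ^ 2) :=
        mul_le_mul_of_nonneg_left hsum (by positivity)
      have h2 : 12 / (n : ℝ) * (2 * n * s ^ 2) = 24 * s ^ 2 := by field_simp; ring
      nlinarith [sq_nonneg s]
  have he1 : eLpNorm (f - g) p μ ≤ ENNReal.ofReal s := by
    refine (eLpNorm_le_of_ae_bound (Filter.Eventually.of_forall hle)).trans ?_
    simp
  calc eLpNorm (f - g - r) p μ ≤ eLpNorm (f - g) p μ + eLpNorm r p μ :=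
        eLpNorm_sub_le he.2.aestronglyMeasurable hrm hp
    _ ≤ ENNReal.ofReal s + ENNReal.ofReal (10 * s * c) := add_le_add he1 hr1
    _ = ENNReal.ofReal (s + 10 * s * c) := (ENNReal.ofReal_add hs (by positivity)).symm
    _ ≤ ENNReal.ofReal (11 * c * s) := ENNReal.ofReal_le_ofReal (by nlinarith)

theorem theorem5p1 :
    ∃ C : ℝ, 0 < C ∧
      (∀ (D : Type*) (F : Set (D → ℂ)), F ⊆ boundedFunctions D →
        ∀ n : ℕ, 1 ≤ n →
          linSamplingNumber (2 * n) F (boundedFunctions D) supNorm ≤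
            ENNReal.ofReal (C * √(n : ℝ)) *
              kolmogorovNumber n F (boundedFunctions D) supNorm) ∧
      (∀ (D : Type*) [MeasurableSpace D] (μ : MeasureTheory.Measure D)
        [MeasureTheory.IsProbabilityMeasure μ] (F : Set (D → ℂ)),
        F ⊆ boundedMeasurableFunctions μ →
        ∀ n : ℕ, 1 ≤ n → ∀ p : ℝ≥0∞, 1 ≤ p →
          linSamplingNumber (4 * n) F (lpFunctions p μ)
              (fun f => MeasureTheory.eLpNorm f p μ) ≤
            ENNReal.ofReal (C * (n : ℝ) ^ max (1 / 2 - (p⁻¹).toReal) 0) *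
              kolmogorovNumber n F (boundedMeasurableFunctions μ) supNorm) := by
  refine ⟨11, by norm_num, fun D F hF n hn => ?_, fun D _ μ _ F hF n hn p hp => ?_⟩
  · refine (linSamplingNumber_boundedFunctions_le hF hn).trans ?_
    gcongr
    norm_num
  · rw [show 4 * n = 2 * n + 2 * n by ring]
    exact (linSamplingNumber_add_self_le _ _ _ _).trans (linSamplingNumber_lpFunctions_le hF hn hp)
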